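/- **Setting.** There are $M$ databases, indexed $1,\dots,M$ in increasing order of service quality, and users whose types are uniformly distributed on $[0,1]$. Let $B$ be the utility of the free basic service and let $\eta_S\in[0,1]$ be the (fixed) market share of sensing. Database $m$ has operational cost $c_m\ge 0$ per subscriber, and its advanced service with market share $x$ has utility $$g_m(x)=\alpha_m+(\beta_m-\alpha_m)\,x^{\gamma_m},\qquad B\le\alpha_m\le\beta_m,\quad \gamma_m\in(0,1].$$ For market shares $\eta=(\eta_1,\dots,\eta_M)\in[0,1]^M$ (with the convention that $g_0$ is the constant $B$), the price of database $m$ is $$p_m(\eta)=\sum_{i=1}^{m}\Bigl(1-\eta_S-\sum_{n=i}^{M}\eta_n\Bigr)\bigl(g_i(\eta_i)-g_{i-1}(\eta_{i-1})\bigr),$$ and its revenue is $U_m(\eta_m,\eta_{-m})=(p_m(\eta)-c_m)\,\eta_m$. In the market-share competition game each database $m$ chooses $\eta_m\in[0,1]$ to maximize $U_m$. **Proposition (Existence of Market Equilibrium under Oligopoly Scenario).** For every database $m$ and all shares $\eta_{-m}\in[0,1]^{M-1}$ of the other databases: 1. the revenue $x\mapsto U_m(x,\eta_{-m})$ is quasi-concave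 on the set of shares $x\in[0,1]$ at which the price covers the cost, $p_m(x,\eta_{-m})\ge c_m$ (in particular this set is convex); 2. if moreover $p_m(0,\eta_{-m})\ge c_m$, then $x\mapsto U_m(x,\eta_{-m})$ is quasi-concave on all of $[0,1]$. The game has a pure-strategy Nash equilibrium $\eta^*\in[0,1]^M$, i.e. $U_m(\eta_m^*,\eta_{-m}^*)\ge U_m(x,\eta_{-m}^*)$ for all $m$ and all $x\in[0,1]$; moreover $\eta^*$ can be chosen with $\eta_S+\sum_{m}\eta^*_m\le 1$, so that it is a genuine profile of market shares. -/

import Mathlib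

noncomputable section

/-- The parameters of an information market with `M` databases.  The databases are indexed by
`Fin M` in increasing order of the quality of their services. -/
structure InformationMarket (M : ℕ) where
  /-- expected utility `B` of the basic service -/
  basic : ℝ
  /-- market share of the sensing service -/
  sensing : ℝ
  /-- minimum benefit of each advanced service -/
  α : Fin M → ℝ
  /-- maximum benefit of each advanced service -/
  β : Fin M → ℝ
  /-- elasticity of each network externality -/
  γ : Fin M → ℝ
  /-- operational cost of each database per subscriber -/
  cost : Fin M → ℝ
  sensing_mem : sensing ∈ Set.Icc (0 : ℝ) 1
  basic_le_α : ∀ m, basic ≤ α m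
  α_le_β : ∀ m, α m ≤ β m
  γ_mem : ∀ m, γ m ∈ Set.Ioc (0 : ℝ) 1
  cost_nonneg : ∀ m, 0 ≤ cost m

namespace InformationMarket

variable {M : ℕ} (K : InformationMarket M)

/-- The positive network externality `g_m(x) = α_m + (β_m - α_m) x ^ γ_m`. -/
def externality (m : Fin M) (x : ℝ) : ℝ :=
  K.α m + (K.β m - K.α m) * x ^ K.γ m

/-- Utility of the service ranked just below database `m`: the advanced service of the preceding
database or, for the first database, the basic service. -/
def lowerUtility (η : Fin M → ℝ) (m : Fin M) : ℝ :=
  if (m : ℕ) = 0 then K.basic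
  else K.externality ⟨(m : ℕ) - 1, by omega⟩ (η ⟨(m : ℕ) - 1, by omega⟩)

/-- The type of the user who is indifferent between database `m` and the service ranked just below
it, when the users of the databases `n ≥ m` and of sensing are exactly the ones with larger type
(types being uniformly distributed in `[0, 1]`). -/
def threshold (η : Fin M → ℝ) (m : Fin M) : ℝ :=
  1 - (K.sensing + ∑ n ∈ Finset.Ici m, η n)

/-- The price of database `m` as a function of the market shares. -/
def price (η : Fin M → ℝ) (m : Fin M) : ℝ :=
  ∑ i ∈ Finset.Iic m, K.threshold η i * (K.externality i (η i) - K.lowerUtility η i)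

/-- The revenue of database `m` in the market share competition game. -/
def revenue (m : Fin M) (η : Fin M → ℝ) : ℝ :=
  (K.price η m - K.cost m) * η m

/-- Pure-strategy Nash equilibria of the market share competition game: every database chooses a
share in `[0, 1]` that is optimal among all shares in `[0, 1]` against the shares of the others. -/
def IsNashEquilibrium (η : Fin M → ℝ) : Prop :=
  ∀ m, η m ∈ Set.Icc (0 : ℝ) 1 ∧
    ∀ x ∈ Set.Icc (0 : ℝ) 1, K.revenue m (Function.update η m x) ≤ K.revenue m η

end InformationMarket

end

/-! Put `s_i = g_i - B ≥ 0` and let `θ_i` be the threshold. Summation by parts (`price_eq`) gives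
`p_m = θ_m s_m(η_m) - ∑_{i<m} η_i s_i(η_i)`, so in its own share `x` a database earns `((T - x)
s_m(x) - C) x` with `T`, `C` constant. For `T ≥ 0` the price is concave; for `T ≤ 0` the revenue
itself is.

Existence needs neither quasi-concavity nor a fixed point: `∑ (θ_i s_i - c_i) η_i` is an exact
potential (`potential_update_sub`), and a maximiser on a compact box is an equilibrium. The box
forces share `0` on databases with `s = 0`. The lowest active database then has positive surplus and
nonnegative revenue, hence `θ ≥ 0`, which bounds the total share. -/

/-- On a convex set of nonnegative reals, the product of the identity and a nonnegative concave
function is quasi-concave. -/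
theorem ConcaveOn.quasiconcaveOn_mul_id_of_nonneg {s : Set ℝ} {f : ℝ → ℝ} (hf : ConcaveOn ℝ s f)
    (hs : ∀ x ∈ s, 0 ≤ x) (hf0 : ∀ x ∈ s, 0 ≤ f x) : QuasiconcaveOn ℝ s (fun x => f x * x) := by
  rw [quasiconcaveOn_iff_min_le]
  refine ⟨hf.1, fun x hx y hy a b ha hb hab => ?_⟩
  have hz := hf.2 hx hy ha hb hab
  simp only [smul_eq_mul] at hz ⊢
  have hx0 := hs x hx
  have hy0 := hs y hy
  have hfx := hf0 x hx
  have hfy := hf0 y hy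
  have h1 : (a * f x + b * f y) * (a * x + b * y) ≤ f (a * x + b * y) * (a * x + b * y) :=
    mul_le_mul_of_nonneg_right hz (by positivity)
  refine le_trans ?_ h1
  obtain rfl : b = 1 - a := by linarith
  -- AM-GM for the cross terms
  set r := min (f x * x) (f y * y) with hr
  have hrx : r ≤ f x * x := min_le_left _ _
  have hry : r ≤ f y * y := min_le_right _ _
  have hr0 : 0 ≤ r := le_min (by positivity) (by positivity)
  have hcross : 2 * r ≤ f x * y + f y * x := by
    have hsq : r * r ≤ (f x * y) * (f y * x) := by
      calc r * r ≤ (f x * x) * (f y * y) := mul_le_mul hrx hry hr0 (by positivity)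
        _ = _ := by ring
    have hn : 0 ≤ f x * y + f y * x := by positivity
    nlinarith [sq_nonneg (f x * y - f y * x)]
  -- Expand the product with weights `a²`, `ab`, `b²`; the lower bounds add up to `(a + b)² r = r`.
  have h2 := mul_le_mul_of_nonneg_left hcross (mul_nonneg ha hb)
  have h3 := mul_le_mul_of_nonneg_left hrx (mul_nonneg ha ha)
  have h4 := mul_le_mul_of_nonneg_left hry (mul_nonneg hb hb)
  nlinarith

/-- The product of the identity and a concave function on `[0, 1]` that is nonnegative at `0` is
quasi-concave. -/
theorem ConcaveOn.quasiconcaveOn_mul_id_of_zero_nonneg {f : ℝ → ℝ}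
    (hf : ConcaveOn ℝ (Set.Icc 0 1) f) (hf0 : 0 ≤ f 0) :
    QuasiconcaveOn ℝ (Set.Icc (0 : ℝ) 1) (fun x => f x * x) := by
  have h01 : (0 : ℝ) ∈ Set.Icc (0 : ℝ) 1 := by simp
  -- The chord from `0` to `y` gives `f z ≥ (z / y) * f y ≥ f y`, and a negative `f y` multiplied by
  -- the smaller share `z` loses less.
  have key : ∀ z y : ℝ, 0 ≤ z → z ≤ y → y ≤ 1 → f y < 0 → f y * y ≤ f z * z := by
    intro z y hz hzy hy1 hfy
    rcases hz.eq_or_lt with rfl | hz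
    · nlinarith
    have hy : 0 < y := hz.trans_le hzy
    have h := hf.2 h01 (⟨hy.le, hy1⟩ : y ∈ Set.Icc (0 : ℝ) 1)
      (sub_nonneg.2 ((div_le_one hy).2 hzy)) (div_nonneg hz.le hy.le) (sub_add_cancel 1 (z / y))
    simp only [smul_eq_mul, mul_zero, zero_add, div_mul_cancel₀ z hy.ne'] at h
    have ht0 : 0 ≤ z / y := by positivity
    have ht1 : z / y ≤ 1 := (div_le_one hy).2 hzy
    have h2 : f y ≤ f z := by nlinarith [mul_nonneg (sub_nonneg.2 ht1) hf0]
    nlinarith [mul_le_mul_of_nonneg_right h2 hz.le]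
  rw [quasiconcaveOn_iff_min_le]
  refine ⟨hf.1, fun x hx y hy a b ha hb hab => ?_⟩
  wlog hxy : x ≤ y generalizing x y a b
  · rw [min_comm, add_comm]
    exact this y hy x hx b a hb ha (by linarith) (le_of_not_ge hxy)
  have hz0 : 0 ≤ a * x + b * y := by
    have := hx.1; have := hy.1; positivity
  have hzy : a * x + b * y ≤ y := by
    obtain rfl : b = 1 - a := by linarith
    nlinarith
  simp only [smul_eq_mul]
  by_cases hfy : f y < 0
  · exact (min_le_right _ _).trans (key _ y hz0 hzy hy.2 hfy)
  · have hnn : ∀ t ∈ Set.Icc 0 y, 0 ≤ f t := by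
      intro t ht
      have hseg : t ∈ segment ℝ 0 y := by rwa [segment_eq_Icc hy.1]
      exact (le_min hf0 (not_lt.1 hfy)).trans (hf.ge_on_segment h01 hy hseg)
    have hq := (hf.subset (Set.Icc_subset_Icc_right hy.2)
      (convex_Icc 0 y)).quasiconcaveOn_mul_id_of_nonneg (fun t ht => ht.1) hnn
    rw [quasiconcaveOn_iff_min_le] at hq
    exact hq.2 ⟨hx.1, hxy⟩ ⟨hy.1, le_rfl⟩ ha hb hab

theorem convexOn_Icc_rpow {p : ℝ} (hp : 1 ≤ p) :
    ConvexOn ℝ (Set.Icc (0 : ℝ) 1) (fun x : ℝ => x ^ p) :=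
  (convexOn_rpow hp).subset Set.Icc_subset_Ici_self (convex_Icc 0 1)

/-! ### Concavity in a database's own share. -/

section DemandCurve

variable {T a δ γ C : ℝ}

theorem concaveOn_linear_mul_rpow (hT : 0 ≤ T) (hδ : 0 ≤ δ) (hγ : γ ∈ Set.Ioc (0 : ℝ) 1) :
    ConcaveOn ℝ (Set.Icc 0 1) (fun x : ℝ => (T - x) * (a + δ * x ^ γ) - C) := by
  have h1 : ConcaveOn ℝ (Set.Icc 0 1) (fun x : ℝ => (δ * T) * x ^ γ) :=
    ((Real.concaveOn_rpow hγ.1.le hγ.2).subset Set.Icc_subset_Ici_self (convex_Icc 0 1)).smul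
      (mul_nonneg hδ hT)
  have h2 : ConvexOn ℝ (Set.Icc 0 1) (fun x : ℝ => δ * x ^ (1 + γ)) :=
    (convexOn_Icc_rpow (by linarith [hγ.1])).smul hδ
  have h3 : ConcaveOn ℝ (Set.Icc 0 1) (fun x : ℝ => (-a) * x) :=
    ((-a) • (LinearMap.id : ℝ →ₗ[ℝ] ℝ)).concaveOn (convex_Icc 0 1)
  refine (((h1.sub h2).add h3).add_const (T * a - C)).congr fun x hx => ?_
  simp only [Pi.add_apply, Pi.sub_apply]
  rw [Real.rpow_one_add' hx.1 (by linarith [hγ.1])]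
  ring

/-- For `T ≤ 0` the term `T * x ^ γ` is convex, but the extra factor `x` raises every exponent to at
least `1`, and the nonlinear powers have nonpositive coefficients. -/
theorem concaveOn_linear_mul_rpow_mul_id (hT : T ≤ 0) (ha : 0 ≤ a) (hδ : 0 ≤ δ)
    (hγ : γ ∈ Set.Ioc (0 : ℝ) 1) :
    ConcaveOn ℝ (Set.Icc 0 1) (fun x : ℝ => ((T - x) * (a + δ * x ^ γ) - C) * x) := by
  have h1 : ConvexOn ℝ (Set.Icc 0 1) (fun x : ℝ => (δ * -T) * x ^ (1 + γ)) :=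
    (convexOn_Icc_rpow (by linarith [hγ.1])).smul (mul_nonneg hδ (neg_nonneg.2 hT))
  have h2 : ConvexOn ℝ (Set.Icc 0 1) (fun x : ℝ => δ * x ^ (2 + γ)) :=
    (convexOn_Icc_rpow (by linarith [hγ.1])).smul hδ
  have h3 : ConcaveOn ℝ (Set.Icc 0 1) (fun x : ℝ => (T * a - C) * x) :=
    ((T * a - C) • (LinearMap.id : ℝ →ₗ[ℝ] ℝ)).concaveOn (convex_Icc 0 1)
  have h4 : ConvexOn ℝ (Set.Icc 0 1) (fun x : ℝ => a * x ^ (2 : ℝ)) :=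
    (convexOn_Icc_rpow (by norm_num)).smul ha
  refine (((h3.sub h1).sub h2).sub h4).congr fun x hx => ?_
  simp only [Pi.sub_apply]
  have hpow1 : x ^ (1 + γ) = x * x ^ γ := Real.rpow_one_add' hx.1 (by linarith [hγ.1])
  have hpow2 : x ^ (2 + γ) = x * (x * x ^ γ) := by
    rw [show 2 + γ = 1 + (1 + γ) by ring, Real.rpow_one_add' hx.1 (by linarith [hγ.1]), hpow1]
  rw [hpow1, hpow2, Real.rpow_two]
  ring

/-- Makes the set where price covers cost convex when `T ≤ 0`. -/
theorem antitoneOn_linear_mul_rpow (hT : T ≤ 0) (ha : 0 ≤ a) (hδ : 0 ≤ δ) (hγ : 0 ≤ γ) :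
    AntitoneOn (fun x : ℝ => (T - x) * (a + δ * x ^ γ) - C) (Set.Icc 0 1) := by
  intro x hx y hy hxy
  have hpow : x ^ γ ≤ y ^ γ := Real.rpow_le_rpow hx.1 hxy hγ
  have h0 : 0 ≤ x ^ γ := Real.rpow_nonneg hx.1 γ
  have h1 : (x - T) * (a + δ * x ^ γ) ≤ (y - T) * (a + δ * y ^ γ) := by
    have := hx.1
    have := hy.1
    gcongr
    linarith
  simp only
  linarith

end DemandCurve

/-! ### Surplus, price and revenue. -/

namespace InformationMarket

variable {M : ℕ} (K : InformationMarket M)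

/-- The benefit of the advanced service over the basic service. -/
noncomputable def surplus (m : Fin M) (x : ℝ) : ℝ := K.externality m x - K.basic

theorem surplus_eq (m : Fin M) (x : ℝ) :
    K.surplus m x = (K.α m - K.basic) + (K.β m - K.α m) * x ^ K.γ m := by
  unfold surplus externality
  ring

theorem surplus_pos {m : Fin M} {x : ℝ} (hx : 0 < x) (h : K.basic < K.β m) :
    0 < K.surplus m x := by
  rw [surplus_eq]
  have h1 := K.basic_le_α m
  have h2 := K.α_le_β m
  have h3 : 0 < x ^ K.γ m := Real.rpow_pos_of_pos hx _
  rcases h1.eq_or_lt with h4 | h4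
  · rw [← h4] at *
    have : 0 < (K.β m - K.basic) * x ^ K.γ m := mul_pos (by linarith) h3
    linarith
  · have : 0 ≤ (K.β m - K.α m) * x ^ K.γ m := mul_nonneg (by linarith) h3.le
    linarith

theorem surplus_nonneg (m : Fin M) {x : ℝ} (hx : 0 ≤ x) : 0 ≤ K.surplus m x := by
  rw [surplus_eq]
  exact add_nonneg (sub_nonneg.2 (K.basic_le_α m))
    (mul_nonneg (sub_nonneg.2 (K.α_le_β m)) (Real.rpow_nonneg hx _))

theorem surplus_eq_zero {m : Fin M} (h : K.β m ≤ K.basic) (x : ℝ) : K.surplus m x = 0 := by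
  have h1 := K.basic_le_α m
  have h2 := K.α_le_β m
  rw [surplus_eq, show K.α m = K.basic by linarith, show K.β m = K.basic by linarith]
  ring

theorem continuous_surplus (m : Fin M) : Continuous (K.surplus m) := by
  have : K.surplus m = fun x => (K.α m - K.basic) + (K.β m - K.α m) * x ^ K.γ m :=
    funext (K.surplus_eq m)
  rw [this]
  exact continuous_const.add (continuous_const.mul (Real.continuous_rpow_const (K.γ_mem m).1.le))

theorem threshold_eq (η : Fin M → ℝ) (m : Fin M) :
    K.threshold η m = 1 - (K.sensing + ∑ n ∈ Finset.Ioi m, η n) - η m := by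
  rw [threshold, ← Finset.Ioi_insert, Finset.sum_insert (by simp)]
  ring

/-- Summation by parts in the price: a database pays, at the margin, for the surplus of all
databases ranked below it. -/
theorem price_eq (η : Fin M → ℝ) (m : Fin M) :
    K.price η m = K.threshold η m * K.surplus m (η m)
      - ∑ i ∈ Finset.Iio m, η i * K.surplus i (η i) := by
  obtain ⟨k, hk⟩ := m
  induction k with
  | zero =>
    have h1 : Finset.Iio (⟨0, hk⟩ : Fin M) = ∅ := by ext ⟨i, hi⟩; simp
    have h2 : Finset.Iic (⟨0, hk⟩ : Fin M) = {⟨0, hk⟩} := by ext ⟨i, hi⟩; simp [Fin.le_def]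
    simp [price, h1, h2, lowerUtility, surplus]
  | succ k ih =>
    have hk' : k < M := by omega
    have h1 : Finset.Iio (⟨k + 1, hk⟩ : Fin M) = Finset.Iic ⟨k, hk'⟩ := by
      ext ⟨i, hi⟩; simp [Fin.le_def, Fin.lt_def]
    have h2 : Finset.Ioi (⟨k, hk'⟩ : Fin M) = Finset.Ici ⟨k + 1, hk⟩ := by
      ext ⟨i, hi⟩; simp [Fin.le_def, Fin.lt_def]
    have hlow : K.lowerUtility η ⟨k + 1, hk⟩ = K.externality ⟨k, hk'⟩ (η ⟨k, hk'⟩) := by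
      simp [lowerUtility]
    have hthr : K.threshold η ⟨k, hk'⟩ = K.threshold η ⟨k + 1, hk⟩ - η ⟨k, hk'⟩ := by
      rw [threshold_eq, h2, threshold]
    have ih' := ih hk'
    rw [price] at ih' ⊢
    rw [← Finset.Iio_insert, Finset.sum_insert (by simp), h1, ih', hlow,
      ← Finset.Iio_insert (⟨k, hk'⟩ : Fin M), Finset.sum_insert (by simp), hthr]
    unfold surplus
    ring

theorem price_update (η : Fin M → ℝ) (m : Fin M) (x : ℝ) :
    K.price (Function.update η m x) m =
      (1 - (K.sensing + ∑ n ∈ Finset.Ioi m, η n) - x) * K.surplus m x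
        - ∑ i ∈ Finset.Iio m, η i * K.surplus i (η i) := by
  have h1 : ∑ n ∈ Finset.Ioi m, Function.update η m x n = ∑ n ∈ Finset.Ioi m, η n :=
    Finset.sum_congr rfl fun n hn => Function.update_of_ne (Finset.mem_Ioi.1 hn).ne' _ _
  have h2 : ∑ i ∈ Finset.Iio m, Function.update η m x i * K.surplus i (Function.update η m x i)
      = ∑ i ∈ Finset.Iio m, η i * K.surplus i (η i) :=
    Finset.sum_congr rfl fun n hn => by
      rw [Function.update_of_ne (Finset.mem_Iio.1 hn).ne]
  rw [price_eq, threshold_eq, h1, h2, Function.update_self]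

theorem revenue_quasiconcaveOn (m : Fin M) (η : Fin M → ℝ) :
    QuasiconcaveOn ℝ
        {x : ℝ | x ∈ Set.Icc (0 : ℝ) 1 ∧ K.cost m ≤ K.price (Function.update η m x) m}
        (fun x => K.revenue m (Function.update η m x)) ∧
      (K.cost m ≤ K.price (Function.update η m 0) m →
        QuasiconcaveOn ℝ (Set.Icc (0 : ℝ) 1)
          (fun x => K.revenue m (Function.update η m x))) := by
  obtain ⟨T, C, hTC⟩ : ∃ T C : ℝ, ∀ x, K.price (Function.update η m x) m - K.cost m =
      (T - x) * ((K.α m - K.basic) + (K.β m - K.α m) * x ^ K.γ m) - C :=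
    ⟨1 - (K.sensing + ∑ n ∈ Finset.Ioi m, η n),
      ∑ i ∈ Finset.Iio m, η i * K.surplus i (η i) + K.cost m, fun x => by
        rw [price_update, surplus_eq]; ring⟩
  have ha : 0 ≤ K.α m - K.basic := sub_nonneg.2 (K.basic_le_α m)
  have hδ : 0 ≤ K.β m - K.α m := sub_nonneg.2 (K.α_le_β m)
  have hγ := K.γ_mem m
  have hrev : (fun x => K.revenue m (Function.update η m x)) = fun x =>
      ((T - x) * ((K.α m - K.basic) + (K.β m - K.α m) * x ^ K.γ m) - C) * x := by
    funext x
    rw [revenue, hTC, Function.update_self]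
  have hset : ∀ x, K.cost m ≤ K.price (Function.update η m x) m ↔
      0 ≤ (T - x) * ((K.α m - K.basic) + (K.β m - K.α m) * x ^ K.γ m) - C := by
    intro x
    rw [← hTC, sub_nonneg]
  simp only [hrev, hset]
  rcases le_total 0 T with hT | hT
  · have hc := concaveOn_linear_mul_rpow (a := K.α m - K.basic) (C := C) hT hδ hγ
    exact ⟨(hc.subset (Set.sep_subset _ _)
        (hc.quasiconcaveOn 0)).quasiconcaveOn_mul_id_of_nonneg (fun x hx => hx.1.1)
        (fun x hx => hx.2),
      fun h0 => hc.quasiconcaveOn_mul_id_of_zero_nonneg h0⟩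
  · have hc := concaveOn_linear_mul_rpow_mul_id (C := C) hT ha hδ hγ
    have hanti := antitoneOn_linear_mul_rpow (C := C) hT ha hδ hγ.1.le
    exact ⟨(hc.subset (Set.sep_subset _ _)
        (hanti.quasiconcaveOn (convex_Icc 0 1) 0)).quasiconcaveOn,
      fun _ => hc.quasiconcaveOn⟩

/-! ### Potential and equilibrium. -/

/-- An exact potential of the market share competition game. -/
noncomputable def potential (η : Fin M → ℝ) : ℝ :=
  ∑ i, (K.threshold η i * K.surplus i (η i) - K.cost i) * η i

theorem continuous_potential : Continuous K.potential := by
  have h := K.continuous_surplus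
  unfold potential threshold
  fun_prop

theorem threshold_update (η : Fin M → ℝ) (m i : Fin M) (x : ℝ) :
    K.threshold (Function.update η m x) i =
      K.threshold η i - if i ≤ m then x - η m else 0 := by
  have h : ∀ n, Function.update η m x n = η n + if n = m then x - η m else 0 := by
    intro n
    by_cases hn : n = m
    · subst hn; simp
    · simp [hn]
  simp only [threshold, h, Finset.sum_add_distrib, Finset.sum_ite_eq', Finset.mem_Ici]
  ring

/-- Besides its own term, database `m` lowers the threshold of each `i < m` by `x - η m`, costing
`(x - η m) * η i * s_i`: exactly what the subtracted sum in `price_eq` charges it. -/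
theorem potential_update_sub (η : Fin M → ℝ) (m : Fin M) (x : ℝ) :
    K.potential (Function.update η m x) - K.potential η =
      K.revenue m (Function.update η m x) - K.revenue m η := by
  have hterm : ∀ i, (K.threshold (Function.update η m x) i *
        K.surplus i (Function.update η m x i) - K.cost i) * Function.update η m x i -
      (K.threshold η i * K.surplus i (η i) - K.cost i) * η i =
      (if i = m then ((K.threshold η m - (x - η m)) * K.surplus m x - K.cost m) * x -
        (K.threshold η m * K.surplus m (η m) - K.cost m) * η m else 0) +
      if i < m then -(x - η m) * (η i * K.surplus i (η i)) else 0 := by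
    intro i
    rw [threshold_update]
    rcases lt_trichotomy i m with h | h | h
    · simp only [Function.update_of_ne h.ne, h.le, h.ne, h, if_true, if_false]
      ring
    · subst h
      simp
    · simp [h.not_ge, h.ne', h.not_gt]
  have hIio : Finset.univ.filter (· < m) = Finset.Iio m := by ext; simp
  rw [potential, potential, ← Finset.sum_sub_distrib, Finset.sum_congr rfl fun i _ => hterm i,
    Finset.sum_add_distrib, ← Finset.sum_filter, ← Finset.sum_filter, hIio, ← Finset.mul_sum,
    revenue, revenue, price_update, price_eq, Function.update_self, threshold_eq]
  simp only [Finset.filter_eq', Finset.mem_univ, if_true, Finset.sum_singleton]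
  ring

theorem revenue_update_zero (m : Fin M) (η : Fin M → ℝ) :
    K.revenue m (Function.update η m 0) = 0 := by
  simp [revenue]

theorem exists_isNashEquilibrium :
    ∃ η : Fin M → ℝ, K.IsNashEquilibrium η ∧ K.sensing + ∑ m, η m ≤ 1 := by
  -- databases without any surplus are kept out of the market
  set u : Fin M → ℝ := fun m => if K.β m ≤ K.basic then 0 else 1 with hu
  have hu0 : ∀ m, 0 ≤ u m := fun m => by simp only [hu]; split_ifs <;> norm_num
  have hu1 : ∀ m, u m ≤ 1 := fun m => by simp only [hu]; split_ifs <;> norm_num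
  obtain ⟨η, hη, hmax⟩ := (isCompact_Icc (a := (0 : Fin M → ℝ)) (b := u)).exists_isMaxOn
    ⟨0, le_rfl, hu0⟩ K.continuous_potential.continuousOn
  have hη0 : ∀ m, 0 ≤ η m := hη.1
  have hηu : ∀ m, η m ≤ u m := hη.2
  have hbest : ∀ m, ∀ x ∈ Set.Icc 0 (u m),
      K.revenue m (Function.update η m x) ≤ K.revenue m η := by
    intro m x hx
    have hmem : Function.update η m x ∈ Set.Icc 0 u :=
      ⟨le_update_iff.2 ⟨hx.1, fun j _ => hη0 j⟩, update_le_iff.2 ⟨hx.2, fun j _ => hηu j⟩⟩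
    have h1 : K.potential (Function.update η m x) ≤ K.potential η := hmax hmem
    linarith [K.potential_update_sub η m x]
  have hrev0 : ∀ m, 0 ≤ K.revenue m η := fun m => by
    simpa [revenue_update_zero] using hbest m 0 ⟨le_rfl, hu0 m⟩
  have hW : ∀ m, 0 ≤ ∑ i ∈ Finset.Iio m, η i * K.surplus i (η i) := fun m =>
    Finset.sum_nonneg fun i _ => mul_nonneg (hη0 i) (K.surplus_nonneg i (hη0 i))
  refine ⟨η, fun m => ⟨⟨hη0 m, (hηu m).trans (hu1 m)⟩, fun x hx => ?_⟩, ?_⟩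
  · by_cases hm : K.β m ≤ K.basic
    -- Without surplus the price is at most `0`, so no share outside the box earns more than `0`
    -- either.
    · refine le_trans ?_ (hrev0 m)
      rw [revenue, price_update, K.surplus_eq_zero hm, Function.update_self]
      exact mul_nonpos_of_nonpos_of_nonneg (by linarith [hW m, K.cost_nonneg m]) hx.1
    · exact hbest m x (by simpa [hu, hm] using hx)
  · by_cases hpos : ∃ m, 0 < η m
    -- Below the lowest active database all shares vanish, so its threshold is `1` minus the total
    -- share.
    · obtain ⟨m, hm, hmin⟩ : ∃ m, 0 < η m ∧ ∀ i < m, η i = 0 := by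
        obtain ⟨m, hm⟩ := exists_minimal_of_wellFoundedLT (fun m => 0 < η m) hpos
        exact ⟨m, hm.prop, fun i hi => le_antisymm (not_lt.1 (hm.not_prop_of_lt hi)) (hη0 i)⟩
      have hβ : K.basic < K.β m := by
        by_contra hcon
        have := hηu m
        simp only [hu, not_lt.1 hcon, if_true] at this
        linarith
      have hs := K.surplus_pos hm hβ
      have hp : K.cost m ≤ K.price η m := by
        have := hrev0 m
        rw [revenue] at this
        exact sub_nonneg.1 (nonneg_of_mul_nonneg_left this hm)
      rw [price_eq] at hp
      have hthr : 0 ≤ K.threshold η m :=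
        nonneg_of_mul_nonneg_left (by linarith [hW m, K.cost_nonneg m]) hs
      have hsum : ∑ n ∈ Finset.Ici m, η n = ∑ n, η n :=
        Finset.sum_subset (Finset.subset_univ _) fun i _ hi => hmin i (by simpa using hi)
      rw [threshold, hsum] at hthr
      linarith
    · push Not at hpos
      have : ∑ m, η m ≤ 0 := Finset.sum_nonpos fun m _ => hpos m
      linarith [K.sensing_mem.2]

end InformationMarket

theorem mainTheorem2 {M : ℕ} (K : InformationMarket M) :
    (∀ (m : Fin M) (η : Fin M → ℝ), (∀ n, η n ∈ Set.Icc (0 : ℝ) 1) →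
      QuasiconcaveOn ℝ
          {x : ℝ | x ∈ Set.Icc (0 : ℝ) 1 ∧ K.cost m ≤ K.price (Function.update η m x) m}
          (fun x => K.revenue m (Function.update η m x)) ∧
        (K.cost m ≤ K.price (Function.update η m 0) m →
          QuasiconcaveOn ℝ (Set.Icc (0 : ℝ) 1)
            (fun x => K.revenue m (Function.update η m x)))) ∧
    ∃ η : Fin M → ℝ, K.IsNashEquilibrium η ∧ K.sensing + ∑ m, η m ≤ 1 := by
  exact ⟨fun m η _ => K.revenue_quasiconcaveOn m η, K.exists_isNashEquilibrium⟩
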